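/- Let $\mathbb{H}$ be the quaternions with standard units $e_1,e_2,e_3=e_1e_2$, and let $\mathfrak{O}=\mathbb{H}\oplus\mathbb{H}e_4$ be the (division) octonions, with multiplication $$(m+ne_4)(m'+n'e_4)=(mm'-\overline{n'}\,n)+(n\,\overline{m'}+n'm)e_4 .$$ Put $\mathbb{C}=\{x+ye_1 : x,y\in\mathbb{R}\}\subset\mathbb{H}$, $U(1)=\{a\in\mathbb{C} : a\bar a=1\}$, $\omega=-\tfrac12+\tfrac{\sqrt3}{2}e_1$, and $e_6=e_4e_2$; every octonion is uniquely of the form $m_0+m_1e_2+m_2e_4+m_3e_6$ with $m_i\in\mathbb{C}$. Let $G_2=\mathrm{Aut}(\mathfrak{O})$ be the group of $\mathbb{R}$-linear bijections $\alpha$ of $\mathfrak{O}$ with $\alpha(xy)=\alpha(x)\alpha(y)$, with the topology of a subgroup of $GL(\mathfrak{O})$. Define $\gamma_3,w_3\in G_2$ by $$\gamma_3(m+ne_4)=m+(\omega n)e_4,\qquad w_3(m_0+m_1e_2+m_2e_4+m_3e_6)=m_0+(\omega m_1)e_2+(\omega m_2)e_4+(\omega m_3)e_6,$$ and let $\tilde\gamma_3(\alpha)=\gamma_3^{-1}\alpha\gamma_3$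 and $\tilde w_3(\alpha)=w_3^{-1}\alpha w_3$ be the corresponding inner automorphisms of $G_2$, with fixed-point subgroups $(G_2)^{\gamma_3}$ and $(G_2)^{w_3}$. Put $K=(G_2)^{\gamma_3}\cap(G_2)^{w_3}$. Theorem. (i) $\gamma_3$ and $w_3$ have order $3$. (ii) The map $$(s,t)\longmapsto\bigl(m+ne_4\mapsto tm\bar t+(sn\bar t)e_4\bigr)$$ induces an isomorphism of topological groups $(U(1)\times U(1))/\mathbb{Z}_2\cong K$, where $\mathbb{Z}_2=\{(1,1),(-1,-1)\}$. (iii) $G_2$ is compact, and $G_2/K=G_2/((U(1)\times U(1))/\mathbb{Z}_2)$ is a $\mathbb{Z}_3\times\mathbb{Z}_3$-symmetric space with respect to the homomorphism $\rho:\mathbb{Z}_3\times\mathbb{Z}_3\to\mathrm{Aut}(G_2)$ with $\rho(1,0)=\tilde\gamma_3$ and $\rho(0,1)=\tilde w_3$. That is: $G_2$ is a connected Lie group (a connected closed subgroup of $GL(\mathfrak{O})$); $\rho$ is a well-defined injective homomorphism into the continuous automorphisms of $G_2$; $(G_2^{\Gamma})_0\subseteq K\subseteq G_2^{\Gamma}$,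 where $G_2^{\Gamma}$ is the subgroup fixed by all $\rho(a)$, $a\in\mathbb{Z}_3\times\mathbb{Z}_3$, and $(G_2^{\Gamma})_0$ is its identity component; and $G_2$ acts almost effectively on $G_2/K$, i.e. the elements acting trivially form a discrete subgroup. -/

import Mathlib

open scoped Quaternion

noncomputable section

/-- The real vector space `𝔒 = ℍ ⊕ ℍ e₄` underlying the octonions, with its Euclidean norm
`|m + n e₄|² = |m|² + |n|²`. -/
def Octonion : Type := WithLp 2 (ℍ[ℝ] × ℍ[ℝ])

namespace Octonion

/-- The quaternion `a + b e₁ + c e₂ + d e₃`. -/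
def quat (a b c d : ℝ) : ℍ[ℝ] := ⟨a, b, c, d⟩

@[simp] theorem re_quat (a b c d : ℝ) : (quat a b c d).re = a := rfl
@[simp] theorem imI_quat (a b c d : ℝ) : (quat a b c d).imI = b := rfl
@[simp] theorem imJ_quat (a b c d : ℝ) : (quat a b c d).imJ = c := rfl
@[simp] theorem imK_quat (a b c d : ℝ) : (quat a b c d).imK = d := rfl

instance : NormedAddCommGroup Octonion :=
  inferInstanceAs (NormedAddCommGroup (WithLp 2 (ℍ[ℝ] × ℍ[ℝ])))

instance : InnerProductSpace ℝ Octonion :=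
  inferInstanceAs (InnerProductSpace ℝ (WithLp 2 (ℍ[ℝ] × ℍ[ℝ])))

instance : FiniteDimensional ℝ Octonion :=
  inferInstanceAs (FiniteDimensional ℝ (WithLp 2 (ℍ[ℝ] × ℍ[ℝ])))

/-- The octonion `m + n e₄`. -/
def mk (m n : ℍ[ℝ]) : Octonion := WithLp.toLp 2 (m, n)

/-- The component `m` of `m + n e₄`. -/
def fst (x : Octonion) : ℍ[ℝ] := WithLp.fst (p := 2) (α := ℍ[ℝ]) (β := ℍ[ℝ]) x

/-- The component `n` of `m + n e₄`. -/
def snd (x : Octonion) : ℍ[ℝ] := WithLp.snd (p := 2) (α := ℍ[ℝ]) (β := ℍ[ℝ]) x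

@[simp] theorem fst_mk (m n : ℍ[ℝ]) : (mk m n).fst = m := rfl
@[simp] theorem snd_mk (m n : ℍ[ℝ]) : (mk m n).snd = n := rfl
@[simp] theorem fst_add (x y : Octonion) : (x + y).fst = x.fst + y.fst := rfl
@[simp] theorem snd_add (x y : Octonion) : (x + y).snd = x.snd + y.snd := rfl
@[simp] theorem fst_smul (r : ℝ) (x : Octonion) : (r • x).fst = r • x.fst := rfl
@[simp] theorem snd_smul (r : ℝ) (x : Octonion) : (r • x).snd = r • x.snd := rfl

@[ext] theorem ext {x y : Octonion} (h₁ : x.fst = y.fst) (h₂ : x.snd = y.snd) : x = y :=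
  WithLp.ofLp_injective (V := ℍ[ℝ] × ℍ[ℝ]) 2 (Prod.ext h₁ h₂)

/-- The Cayley multiplication
`(m + n e₄)(m' + n' e₄) = (m m' - n̄' n) + (n m̄' + n' m) e₄`. -/
instance : Mul Octonion where
  mul x y := mk (x.fst * y.fst - star y.snd * x.snd) (x.snd * star y.fst + y.snd * x.fst)

@[simp] theorem fst_mul (x y : Octonion) :
    (x * y).fst = x.fst * y.fst - star y.snd * x.snd := rfl
@[simp] theorem snd_mul (x y : Octonion) :
    (x * y).snd = x.snd * star y.fst + y.snd * x.fst := rfl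

/-- The inclusion `ℂ = {x + y e₁} ⊂ ℍ ⊂ 𝔒`, where `e₁` is the quaternion unit `i`. -/
def ofComplex (z : ℂ) : Octonion := mk (z : ℍ[ℝ]) 0

@[simp] theorem fst_ofComplex (z : ℂ) : (ofComplex z).fst = (z : ℍ[ℝ]) := rfl
@[simp] theorem snd_ofComplex (z : ℂ) : (ofComplex z).snd = 0 := rfl

/-- `e₂`, the quaternion unit `j`. -/
def e₂ : Octonion := mk (quat 0 0 1 0) 0

/-- `e₄`, the unit adjoined to `ℍ`. -/
def e₄ : Octonion := mk 0 1

/-- `e₆ = e₄ e₂`. -/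
def e₆ : Octonion := e₄ * e₂

/-- The octonion `m₀ + m₁ e₂ + m₂ e₄ + m₃ e₆` attached to `(m₀, (m₁, m₂, m₃)) ∈ ℂ ⊕ ℂ³`. -/
def ofComplexCoords (m₀ m₁ m₂ m₃ : ℂ) : Octonion :=
  ofComplex m₀ + ofComplex m₁ * e₂ + ofComplex m₂ * e₄ + ofComplex m₃ * e₆

theorem ofComplexCoords_eq (m₀ m₁ m₂ m₃ : ℂ) :
    ofComplexCoords m₀ m₁ m₂ m₃ =
      mk (quat m₀.re m₀.im m₁.re m₁.im) (quat m₂.re m₂.im (-m₃.re) m₃.im) := by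
  ext <;> simp [ofComplexCoords, e₂, e₄, e₆]

/-- The identification `𝔒 = ℂ ⊕ ℂ³`; its inverse is
`(m₀, (m₁, m₂, m₃)) ↦ m₀ + m₁ e₂ + m₂ e₄ + m₃ e₆`. -/
def complexCoords : Octonion ≃ₗ[ℝ] ℂ × (Fin 3 → ℂ) where
  toFun x := (⟨x.fst.re, x.fst.imI⟩,
    ![⟨x.fst.imJ, x.fst.imK⟩, ⟨x.snd.re, x.snd.imI⟩, ⟨-x.snd.imJ, x.snd.imK⟩])
  invFun m := ofComplexCoords m.1 (m.2 0) (m.2 1) (m.2 2)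
  left_inv x := by ext <;> simp [ofComplexCoords_eq]
  right_inv m := by
    simp only [ofComplexCoords_eq]
    refine Prod.ext (by simp) (funext fun i => ?_)
    fin_cases i <;> simp
  map_add' x y := by
    refine Prod.ext rfl (funext fun i => ?_)
    fin_cases i <;> apply Complex.ext <;> simp [add_comm]
  map_smul' r x := by
    refine Prod.ext ?_ (funext fun i => ?_)
    · apply Complex.ext <;> simp
    · fin_cases i <;> apply Complex.ext <;> simp

end Octonion

/-- The group `G₂` of all `ℝ`-linear bijections `α` of `𝔒` with `α(xy) = (αx)(αy)`, as a
topological subgroup of `GL(𝔒)`. -/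
def G₂ : Subgroup (Octonion →L[ℝ] Octonion)ˣ where
  carrier := {α | ∀ x y : Octonion, α.1 (x * y) = α.1 x * α.1 y}
  one_mem' _ _ := rfl
  mul_mem' {α β} hα hβ x y := by
    change α.1 (β.1 (x * y)) = α.1 (β.1 x) * α.1 (β.1 y)
    rw [hβ, hα]
  inv_mem' {α} hα x y := by
    have h₁ : ∀ z, α.1 (α⁻¹.1 z) = z := fun z => DFunLike.congr_fun α.mul_inv z
    have h₂ : ∀ z, α⁻¹.1 (α.1 z) = z := fun z => DFunLike.congr_fun α.inv_mul z
    have h := hα (α⁻¹.1 x) (α⁻¹.1 y)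
    rw [h₁, h₁] at h
    rw [← h, h₂]

/-- A multiplicative linear bijection of `𝔒` as an element of `G₂`. -/
def G₂.ofLinearEquiv (f : Octonion ≃ₗ[ℝ] Octonion)
    (hf : ∀ x y : Octonion, f (x * y) = f x * f y) : G₂ :=
  ⟨ContinuousLinearEquiv.toUnit f.toContinuousLinearEquiv, hf⟩

/-- `ω = -1/2 + (√3/2) e₁ ∈ ℂ`. -/
def omega₃ : ℂ := ⟨-(1 / 2), √3 / 2⟩

theorem omega₃_mul_conj : omega₃ * star omega₃ = 1 := by
  have h : √3 * √3 = 3 := Real.mul_self_sqrt (by norm_num)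
  apply Complex.ext <;> simp [omega₃] <;> nlinarith

theorem conj_mul_omega₃ : star omega₃ * omega₃ = 1 := by
  rw [mul_comm, omega₃_mul_conj]

/-- The linear map `γ₃(m + n e₄) = m + (ω n) e₄`. -/
def gamma₃Lin : Octonion ≃ₗ[ℝ] Octonion where
  toFun x := .mk x.fst ((omega₃ : ℍ[ℝ]) * x.snd)
  invFun x := .mk x.fst (((star omega₃ : ℂ) : ℍ[ℝ]) * x.snd)
  left_inv x := by
    apply Octonion.ext
    · simp
    · simp only [Octonion.snd_mk]
      rw [← mul_assoc, ← Quaternion.coeComplex_mul, conj_mul_omega₃, Quaternion.coeComplex_one,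
        one_mul]
  right_inv x := by
    apply Octonion.ext
    · simp
    · simp only [Octonion.snd_mk]
      rw [← mul_assoc, ← Quaternion.coeComplex_mul, omega₃_mul_conj, Quaternion.coeComplex_one,
        one_mul]
  map_add' x y := by apply Octonion.ext <;> simp [mul_add]
  map_smul' r x := by apply Octonion.ext <;> simp

/-- The linear map `w₃(m₀ + 𝐦) = m₀ + ω 𝐦` on `𝔒 = ℂ ⊕ ℂ³`. -/
def w₃Lin : Octonion ≃ₗ[ℝ] Octonion :=
  Octonion.complexCoords.trans <|
    LinearEquiv.trans
      { toFun := fun m => (m.1, omega₃ • m.2)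
        invFun := fun m => (m.1, star omega₃ • m.2)
        left_inv := fun m => by simp only [smul_smul, conj_mul_omega₃, one_smul]
        right_inv := fun m => by simp only [smul_smul, omega₃_mul_conj, one_smul]
        map_add' := fun m n => by simp
        map_smul' := fun r m => by
          refine Prod.ext rfl ?_
          simp only [Prod.smul_snd, RingHom.id_apply]
          exact smul_comm _ _ _ }
      Octonion.complexCoords.symm

theorem coeComplex_star₃ (z : ℂ) : ((star z : ℂ) : ℍ[ℝ]) = star (z : ℍ[ℝ]) := by
  ext <;> simp

theorem gamma₃Lin_apply (x : Octonion) :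
    gamma₃Lin x = .mk x.fst ((omega₃ : ℍ[ℝ]) * x.snd) := rfl

theorem w₃Lin_apply (x : Octonion) :
    w₃Lin x = .mk (((star omega₃ : ℂ) : ℍ[ℝ]) * x.fst * (omega₃ : ℍ[ℝ]))
      (x.snd * (omega₃ : ℍ[ℝ])) := by
  have h : √3 * √3 = 3 := Real.mul_self_sqrt (by norm_num)
  have h₁ : w₃Lin x = Octonion.ofComplexCoords ⟨x.fst.re, x.fst.imI⟩
    (omega₃ * ⟨x.fst.imJ, x.fst.imK⟩) (omega₃ * ⟨x.snd.re, x.snd.imI⟩)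
    (omega₃ * ⟨-x.snd.imJ, x.snd.imK⟩) := rfl
  rw [h₁, Octonion.ofComplexCoords_eq]
  ext <;> simp [omega₃] <;> grind

theorem gamma₃Lin_mul (x y : Octonion) :
    gamma₃Lin (x * y) = gamma₃Lin x * gamma₃Lin y := by
  have h : star (omega₃ : ℍ[ℝ]) * (omega₃ : ℍ[ℝ]) = 1 := by
    rw [← coeComplex_star₃, ← Quaternion.coeComplex_mul, conj_mul_omega₃,
      Quaternion.coeComplex_one]
  apply Octonion.ext
  · simp only [gamma₃Lin_apply, Octonion.fst_mk, Octonion.snd_mk, Octonion.fst_mul, star_mul]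
    rw [mul_assoc (star y.snd), ← mul_assoc _ _ x.snd, h, one_mul]
  · simp only [gamma₃Lin_apply, Octonion.fst_mk, Octonion.snd_mk, Octonion.snd_mul, mul_add,
      mul_assoc]

theorem w₃Lin_mul (x y : Octonion) : w₃Lin (x * y) = w₃Lin x * w₃Lin y := by
  have h : (omega₃ : ℍ[ℝ]) * star (omega₃ : ℍ[ℝ]) = 1 := by
    rw [← coeComplex_star₃, ← Quaternion.coeComplex_mul, omega₃_mul_conj,
      Quaternion.coeComplex_one]
  have h' : ∀ z : ℍ[ℝ], (omega₃ : ℍ[ℝ]) * (star (omega₃ : ℍ[ℝ]) * z) = z := fun z => by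
    rw [← mul_assoc, h, one_mul]
  apply Octonion.ext
  · simp only [w₃Lin_apply, Octonion.fst_mk, Octonion.snd_mk, Octonion.fst_mul, star_mul,
      coeComplex_star₃, mul_assoc, h', mul_sub, sub_mul]
  · simp only [w₃Lin_apply, Octonion.fst_mk, Octonion.snd_mk, Octonion.snd_mul, star_mul,
      coeComplex_star₃, star_star, mul_assoc, h', add_mul]

/-- `γ₃ ∈ G₂`. -/
def gamma₃ : G₂ := G₂.ofLinearEquiv gamma₃Lin gamma₃Lin_mul

/-- `w₃ ∈ G₂`. -/
def w₃ : G₂ := G₂.ofLinearEquiv w₃Lin w₃Lin_mul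

section GammaSymmetric

/-- The inner automorphism `g̃(α) = g⁻¹ α g`. -/
def tildeAut {G : Type*} [Group G] (g : G) : MulAut G := MulAut.conj g⁻¹

/-- The fixed-point subgroup `G^σ = {α ∈ G | σ(α) = α}`. -/
def fixedSubgroup {G : Type*} [Group G] (σ : MulAut G) : Subgroup G where
  carrier := {α | σ α = α}
  one_mem' := map_one σ
  mul_mem' {a b} ha hb := by
    change σ (a * b) = a * b
    rw [map_mul, ha, hb]
  inv_mem' {a} ha := by
    change σ a⁻¹ = a⁻¹
    rw [map_inv, ha]

/-- The subgroup `G^Γ` fixed by all automorphisms `ρ(a)`, `a ∈ Γ`. -/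
def fixedSubgroupOfHom {Γ G : Type*} [Group Γ] [Group G] (ρ : Γ →* MulAut G) : Subgroup G :=
  ⨅ a : Γ, fixedSubgroup (ρ a)

/-- `G/K` is a `Γ`-symmetric space with respect to `ρ : Γ → Aut(G)`. Here `Γ` is a finite abelian
group, and the connected Lie group `G` is given as a closed subgroup of `GL(V)`, for a
finite-dimensional real vector space `V`. The Lie group automorphisms of `G` are its group
automorphisms that are homeomorphisms. -/
structure IsGammaSymmetricVia {V : Type*} [NormedAddCommGroup V] [NormedSpace ℝ V]
    [FiniteDimensional ℝ V] {Γ : Type*} [CommGroup Γ] [Finite Γ]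
    (G : Subgroup (V →L[ℝ] V)ˣ) (K : Subgroup G) (ρ : Γ →* MulAut G) : Prop where
  /-- `G` is a closed subgroup of `GL(V)`. -/
  isClosed : IsClosed (G : Set (V →L[ℝ] V)ˣ)
  /-- `G` is connected. -/
  connected : ConnectedSpace G
  /-- `G` acts almost effectively on `G/K`: the elements that act trivially form a discrete
  subgroup. -/
  almostEffective : DiscreteTopology (MulAction.toPermHom G (G ⧸ K)).ker
  /-- Each `ρ(a)` is continuous; so is its inverse `ρ(a⁻¹)`. -/
  continuous : ∀ a, Continuous (ρ a)
  /-- `ρ` is injective. -/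
  injective : Function.Injective ρ
  /-- `(G^Γ)₀ ⊆ K`, where `(G^Γ)₀` is the identity component of `G^Γ`. -/
  identityComponent_le :
    (Subgroup.connectedComponentOfOne (fixedSubgroupOfHom ρ)).map
      (fixedSubgroupOfHom ρ).subtype ≤ K
  /-- `K ⊆ G^Γ`. -/
  le_fixed : K ≤ fixedSubgroupOfHom ρ

end GammaSymmetric

/-- `ℤ₂ = {(1, 1), (-1, -1)}` in `U(1) × U(1)`. -/
def diagZ₂ : Subgroup (Circle × Circle) where
  carrier := {(1, 1), (-1, -1)}
  one_mem' := Or.inl rfl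
  mul_mem' {a b} ha hb := by
    rcases ha with rfl | rfl <;> rcases hb with rfl | rfl <;> simp
  inv_mem' {a} ha := by
    rcases ha with rfl | rfl
    · simp
    · right
      refine Prod.ext ?_ ?_ <;> exact inv_eq_of_mul_eq_one_left (by simp)

end

/-! Every octonion satisfies a quadratic equation whose coefficients are its real part and norm, so
automorphisms are isometries (`re_and_norm`) and `G₂` is compact.

For connectedness, the images of `S³ × S³` and of a circle of rotations lie in the identity
component. They suffice to move any imaginary unit to `e₂`, keeping `e₁` fixed when the unit is
orthogonal to `e₁` (`exists_apply_eq_e₂`). Hence any automorphism can be corrected within the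
component until it fixes `ℍ`; it then comes from `S³` (`exists_eq_ofPair`).

Both `γ₃` and `w₃` lie in the image of the torus `U(1) × U(1)`, which therefore lies in `K`.
Conversely, an element of `K` preserves `ℍ` and `ℂ`, so it sends `e₁` to `± e₁`; the action of `w₃`
on `e₂` excludes the minus sign (`apply_e₁_of_mem`). Correcting by the torus then leaves only torus
elements (`exists_ofCirclePair_eq`).

Since `K` fixes `e₁`, an element all of whose conjugates lie in `K` fixes the orbit of `e₁`, which
contains the generators `e₁`, `e₂`, `e₄`. This gives effectiveness and, applied to central elements,
injectivity of `ρ`. -/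

noncomputable section

/-! ### Octonion algebra: unit, generators, quadratic equation, continuity. -/

namespace Octonion

@[simp] theorem fst_sub (x y : Octonion) : (x - y).fst = x.fst - y.fst := rfl
@[simp] theorem snd_sub (x y : Octonion) : (x - y).snd = x.snd - y.snd := rfl
@[simp] theorem fst_neg (x : Octonion) : (-x).fst = -x.fst := rfl
@[simp] theorem snd_neg (x : Octonion) : (-x).snd = -x.snd := rfl
@[simp] theorem fst_zero : (0 : Octonion).fst = 0 := rfl
@[simp] theorem snd_zero : (0 : Octonion).snd = 0 := rfl

/-- The octonion unit `1`. -/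
def unit : Octonion := mk 1 0

/-- `e₁`, the quaternion unit `i`. -/
def e₁ : Octonion := mk (quat 0 1 0 0) 0

theorem unit_mul (x : Octonion) : unit * x = x := by
  ext <;> simp [unit]

theorem mul_unit (x : Octonion) : x * unit = x := by
  ext <;> simp [unit]

theorem eq_combination (x : Octonion) :
    x = x.fst.re • unit + x.fst.imI • e₁ + x.fst.imJ • e₂ + x.fst.imK • (e₁ * e₂) +
      x.snd.re • e₄ + x.snd.imI • (e₁ * e₄) + x.snd.imJ • (e₂ * e₄) +
      x.snd.imK • ((e₁ * e₂) * e₄) := by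
  ext <;> simp [unit, e₁, e₂, e₄]

theorem norm_sq_eq (x : Octonion) :
    ‖x‖ ^ 2 = Quaternion.normSq x.fst + Quaternion.normSq x.snd := by
  rw [Quaternion.normSq_eq_norm_mul_self, Quaternion.normSq_eq_norm_mul_self, ← sq, ← sq]
  exact WithLp.prod_norm_sq_eq_of_L2 (α := ℍ[ℝ]) (β := ℍ[ℝ]) x

/-- Every octonion satisfies its quadratic equation. -/
theorem mul_self_eq (x : Octonion) :
    x * x = (2 * x.fst.re) • x - (‖x‖ ^ 2) • unit := by
  rw [norm_sq_eq]
  ext <;> simp [unit, Quaternion.normSq_def'] <;> ring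

theorem continuous_fst : Continuous fst :=
  WithLp.continuous_fst (p := 2) (α := ℍ[ℝ]) (β := ℍ[ℝ])

theorem continuous_snd : Continuous snd :=
  WithLp.continuous_snd (p := 2) (α := ℍ[ℝ]) (β := ℍ[ℝ])

theorem continuous_mk {X : Type*} [TopologicalSpace X] {f g : X → ℍ[ℝ]} (hf : Continuous f)
    (hg : Continuous g) : Continuous fun x => mk (f x) (g x) :=
  (WithLp.prod_continuous_toLp 2 ℍ[ℝ] ℍ[ℝ]).comp (hf.prodMk hg)

theorem continuous_mul {X : Type*} [TopologicalSpace X] {f g : X → Octonion} (hf : Continuous f)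
    (hg : Continuous g) : Continuous fun x => f x * g x := by
  have h₁ := continuous_fst.comp hf
  have h₂ := continuous_snd.comp hf
  have h₃ := continuous_fst.comp hg
  have h₄ := continuous_snd.comp hg
  exact continuous_mk ((h₁.mul h₃).sub (h₄.star.mul h₂)) ((h₂.mul h₃.star).add (h₄.mul h₁))

end Octonion

/-! ### Automorphisms are isometries; compactness of `G₂`. -/

namespace G₂

open Octonion

theorem map_mul' (α : G₂) (x y : Octonion) : α.1.1 (x * y) = α.1.1 x * α.1.1 y := α.2 x y

theorem inv_apply_apply (α : G₂) (x : Octonion) : (α⁻¹).1.1 (α.1.1 x) = x :=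
  DFunLike.congr_fun α.1.inv_mul x

theorem apply_inv_apply (α : G₂) (x : Octonion) : α.1.1 ((α⁻¹).1.1 x) = x :=
  DFunLike.congr_fun α.1.mul_inv x

theorem mul_apply (α β : G₂) (x : Octonion) : (α * β).1.1 x = α.1.1 (β.1.1 x) := rfl

theorem one_apply (x : Octonion) : (1 : G₂).1.1 x = x := rfl

theorem ext_apply {α β : G₂} (h : ∀ x, α.1.1 x = β.1.1 x) : α = β :=
  Subtype.ext (Units.ext (ContinuousLinearMap.ext h))

theorem inv_apply_eq {α : G₂} {x y : Octonion} (h : α.1.1 x = y) : (α⁻¹).1.1 y = x := by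
  rw [← h, inv_apply_apply]

theorem map_unit (α : G₂) : α.1.1 unit = unit := by
  have h := map_mul' α ((α⁻¹).1.1 unit) unit
  rwa [Octonion.mul_unit, apply_inv_apply, unit_mul, eq_comm] at h

/-- An automorphism of `𝔒` is determined by its values at `e₁`, `e₂` and `e₄`. -/
theorem ext_generators {α β : G₂} (h₁ : α.1.1 e₁ = β.1.1 e₁) (h₂ : α.1.1 e₂ = β.1.1 e₂)
    (h₄ : α.1.1 e₄ = β.1.1 e₄) : α = β := by
  refine ext_apply fun x => ?_
  rw [eq_combination x]
  simp only [map_add, map_smul, map_mul', map_unit, h₁, h₂, h₄]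

/-- Automorphisms of `𝔒` preserve real parts and norms. -/
theorem re_and_norm (α : G₂) (x : Octonion) :
    (α.1.1 x).fst.re = x.fst.re ∧ ‖α.1.1 x‖ = ‖x‖ := by
  -- Compare the quadratic equation of `α x` with the image under `α` of that of `x`.
  have h₁ : (2 * ((α.1.1 x).fst.re - x.fst.re)) • α.1.1 x
      = (‖α.1.1 x‖ ^ 2 - ‖x‖ ^ 2) • unit := by
    have h := map_mul' α x x
    rw [mul_self_eq x, mul_self_eq (α.1.1 x), map_sub, map_smul, map_smul, map_unit] at h
    rw [mul_sub, sub_smul, sub_smul]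
    rw [sub_eq_sub_iff_add_eq_add] at h ⊢
    rw [← h, add_comm]
  by_cases h₂ : (α.1.1 x).fst.re - x.fst.re = 0
  · refine ⟨sub_eq_zero.1 h₂, ?_⟩
    have h₃ := congrArg (fun y : Octonion => y.fst.re) h₁
    simp only [h₂, mul_zero, zero_smul, fst_zero, fst_smul, unit, fst_mk, Quaternion.re_zero,
      Quaternion.re_smul, Quaternion.re_one, smul_eq_mul, mul_one] at h₃
    exact (sq_eq_sq₀ (norm_nonneg _) (norm_nonneg _)).1 (sub_eq_zero.1 h₃.symm)
  -- If the real parts differed, `α x` would be a real scalar, and so would `x`; but `α` fixes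
  -- scalars.
  · obtain ⟨r, hr⟩ : ∃ r : ℝ, α.1.1 x = r • unit := by
      refine ⟨(2 * ((α.1.1 x).fst.re - x.fst.re))⁻¹ * (‖α.1.1 x‖ ^ 2 - ‖x‖ ^ 2), ?_⟩
      rw [mul_smul, ← h₁, smul_smul, inv_mul_cancel₀ (mul_ne_zero two_ne_zero h₂), one_smul]
    have hx : x = r • unit := by
      rw [← inv_apply_apply α x, hr, map_smul, map_unit]
    rw [hr, hx]
    exact ⟨rfl, rfl⟩

theorem re_apply (α : G₂) (x : Octonion) : (α.1.1 x).fst.re = x.fst.re := (re_and_norm α x).1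

theorem norm_apply (α : G₂) (x : Octonion) : ‖α.1.1 x‖ = ‖x‖ := (re_and_norm α x).2

theorem isClosed_coe : IsClosed (G₂ : Set (Octonion →L[ℝ] Octonion)ˣ) := by
  have h : (G₂ : Set (Octonion →L[ℝ] Octonion)ˣ) =
      ⋂ x : Octonion, ⋂ y : Octonion, {α | α.1 (x * y) = α.1 x * α.1 y} := by
    ext α
    simp only [Set.mem_iInter]
    exact Iff.rfl
  have hc : ∀ x : Octonion,
      Continuous fun α : (Octonion →L[ℝ] Octonion)ˣ => α.1 x :=
    fun x => Units.continuous_val.clm_apply continuous_const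
  rw [h]
  exact isClosed_iInter fun x => isClosed_iInter fun y =>
    isClosed_eq (hc _) (Octonion.continuous_mul (hc x) (hc y))

/-- The unit group carries the topology of the pairs `(α, α⁻¹)`, so both entries have to be bounded;
both are isometries. -/
theorem isCompact_coe : IsCompact (G₂ : Set (Octonion →L[ℝ] Octonion)ˣ) := by
  have hn : ∀ α : G₂, ‖α.1.1‖ ≤ 1 := fun α =>
    ContinuousLinearMap.opNorm_le_bound _ zero_le_one fun x => by rw [norm_apply, one_mul]
  have hB : IsCompact (Metric.closedBall (0 : Octonion →L[ℝ] Octonion) 1) :=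
    isCompact_closedBall _ _
  have hB' := hB.prod (hB.image MulOpposite.continuous_op)
  refine (Units.isClosedEmbedding_embedProduct.isCompact_preimage hB').of_isClosed_subset
    isClosed_coe fun α hα => ?_
  exact ⟨mem_closedBall_zero_iff.2 (hn ⟨α, hα⟩),
    ⟨_, mem_closedBall_zero_iff.2 (hn (⟨α, hα⟩ : G₂)⁻¹), rfl⟩⟩

/-- A map to `G₂` is continuous once it and its inverse are so pointwise. -/
theorem continuous_of_apply {X : Type*} [TopologicalSpace X] {f : X → G₂}
    (h : ∀ x, Continuous fun a => (f a).1.1 x) (h' : ∀ x, Continuous fun a => ((f a)⁻¹).1.1 x) :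
    Continuous f :=
  Continuous.subtype_mk
    (Units.continuous_iff.2 ⟨continuous_clm_apply.2 h, continuous_clm_apply.2 h'⟩) _

/-! ### Explicit subgroups of `G₂`: the image of `S³ × S³` and a circle of rotations. -/

/-- The group `S³` of unit quaternions. -/
abbrev UnitQuaternion : Type := Metric.sphere (0 : ℍ[ℝ]) 1

theorem star_mul_self (q : UnitQuaternion) : star (q : ℍ[ℝ]) * (q : ℍ[ℝ]) = 1 := by
  rw [Quaternion.star_mul_self, Quaternion.normSq_eq_norm_mul_self, mem_sphere_zero_iff_norm.1 q.2]
  simp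

theorem self_mul_star (q : UnitQuaternion) : (q : ℍ[ℝ]) * star (q : ℍ[ℝ]) = 1 := by
  rw [Quaternion.self_mul_star, Quaternion.normSq_eq_norm_mul_self, mem_sphere_zero_iff_norm.1 q.2]
  simp

theorem star_mul_self_mul (q : UnitQuaternion) (z : ℍ[ℝ]) : star (q : ℍ[ℝ]) * (q * z) = z := by
  rw [← mul_assoc, star_mul_self, one_mul]

theorem self_mul_star_mul (q : UnitQuaternion) (z : ℍ[ℝ]) :
    (q : ℍ[ℝ]) * (star (q : ℍ[ℝ]) * z) = z := by
  rw [← mul_assoc, self_mul_star, one_mul]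

/-- The linear map `m + n e₄ ↦ q m q̄ + (p n q̄) e₄`. -/
def pairLin (p q : UnitQuaternion) : Octonion ≃ₗ[ℝ] Octonion where
  toFun x := .mk (q * x.fst * star (q : ℍ[ℝ])) (p * x.snd * star (q : ℍ[ℝ]))
  invFun x := .mk (star (q : ℍ[ℝ]) * x.fst * q) (star (p : ℍ[ℝ]) * x.snd * q)
  left_inv x := by
    apply Octonion.ext <;> simp [mul_assoc, star_mul_self_mul, star_mul_self]
  right_inv x := by
    apply Octonion.ext <;> simp [mul_assoc, self_mul_star_mul, self_mul_star]
  map_add' x y := by apply Octonion.ext <;> simp [mul_add, add_mul]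
  map_smul' r x := by apply Octonion.ext <;> simp

theorem pairLin_mul (p q : UnitQuaternion) (x y : Octonion) :
    pairLin p q (x * y) = pairLin p q x * pairLin p q y := by
  apply Octonion.ext <;>
  simp [pairLin, mul_assoc, star_mul_self_mul, mul_sub, sub_mul, mul_add, add_mul]

/-- The action of `S³ × S³` on `𝔒` by `m + n e₄ ↦ q m q̄ + (p n q̄) e₄`. -/
def ofPair : UnitQuaternion × UnitQuaternion →* G₂ where
  toFun a := ofLinearEquiv (pairLin a.1 a.2) (pairLin_mul a.1 a.2)
  map_one' := ext_apply fun x => by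
    change pairLin 1 1 x = x
    apply Octonion.ext <;> simp [pairLin]
  map_mul' a b := ext_apply fun x => by
    change pairLin (a.1 * b.1) (a.2 * b.2) x = pairLin a.1 a.2 (pairLin b.1 b.2 x)
    apply Octonion.ext <;> simp [pairLin, mul_assoc]

theorem ofPair_apply (p q : UnitQuaternion) (x : Octonion) :
    (ofPair (p, q)).1.1 x =
      .mk (q * x.fst * star (q : ℍ[ℝ])) (p * x.snd * star (q : ℍ[ℝ])) := rfl

theorem continuous_ofPair : Continuous ofPair := by
  have h : ∀ x, Continuous fun a => (ofPair a).1.1 x := fun x => by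
    refine continuous_mk ?_ ?_ <;> fun_prop
  refine continuous_of_apply h fun x => ?_
  simp_rw [← map_inv]
  exact (h x).comp continuous_inv

/-- The rotation `e₂ ↦ z.re e₂ + z.im e₄`, `e₄ ↦ -z.im e₂ + z.re e₄` of `ℂ e₂ ⊕ ℂ e₄` by
`z ∈ U(1)`, extended by the identity of `ℂ ⊕ ℂ e₆`. -/
def rotationFun (z : Circle) (x : Octonion) : Octonion :=
  .mk (quat x.fst.re x.fst.imI ((z : ℂ).re * x.fst.imJ - (z : ℂ).im * x.snd.re)
      ((z : ℂ).re * x.fst.imK - (z : ℂ).im * x.snd.imI))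
    (quat ((z : ℂ).im * x.fst.imJ + (z : ℂ).re * x.snd.re)
      ((z : ℂ).im * x.fst.imK + (z : ℂ).re * x.snd.imI) x.snd.imJ x.snd.imK)

theorem re_sq_add_im_sq (z : Circle) : (z : ℂ).re * (z : ℂ).re + (z : ℂ).im * (z : ℂ).im = 1 := by
  rw [← Complex.normSq_apply, Circle.normSq_coe]

theorem rotationFun_mul_circle (z w : Circle) (x : Octonion) :
    rotationFun (z * w) x = rotationFun z (rotationFun w x) := by
  apply Octonion.ext <;> ext <;> simp [rotationFun] <;> ring

theorem rotationFun_one (x : Octonion) : rotationFun 1 x = x := by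
  apply Octonion.ext <;> ext <;> simp [rotationFun]

theorem rotationFun_mul (z : Circle) (x y : Octonion) :
    rotationFun z (x * y) = rotationFun z x * rotationFun z y := by
  have h := re_sq_add_im_sq z
  apply Octonion.ext <;> ext <;> simp [rotationFun] <;> grind

/-- The rotation `rotationFun` as a linear equivalence. -/
def rotationLin (z : Circle) : Octonion ≃ₗ[ℝ] Octonion where
  toFun := rotationFun z
  invFun := rotationFun z⁻¹
  left_inv x := by rw [← rotationFun_mul_circle, inv_mul_cancel, rotationFun_one]
  right_inv x := by rw [← rotationFun_mul_circle, mul_inv_cancel, rotationFun_one]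
  map_add' x y := by apply Octonion.ext <;> ext <;> simp [rotationFun] <;> ring
  map_smul' r x := by apply Octonion.ext <;> ext <;> simp [rotationFun] <;> ring

/-- The rotations `rotationFun` form a one-parameter subgroup of `G₂`. -/
def rotation : Circle →* G₂ where
  toFun z := ofLinearEquiv (rotationLin z) (rotationFun_mul z)
  map_one' := ext_apply rotationFun_one
  map_mul' z w := ext_apply (rotationFun_mul_circle z w)

theorem rotation_apply (z : Circle) (x : Octonion) : (rotation z).1.1 x = rotationFun z x := rfl

theorem continuous_quat {X : Type*} [TopologicalSpace X] {a b c d : X → ℝ} (ha : Continuous a)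
    (hb : Continuous b) (hc : Continuous c) (hd : Continuous d) :
    Continuous fun x => quat (a x) (b x) (c x) (d x) := by
  have h : ∀ x, quat (a x) (b x) (c x) (d x) =
      a x • quat 1 0 0 0 + b x • quat 0 1 0 0 + c x • quat 0 0 1 0 + d x • quat 0 0 0 1 :=
    fun x => by ext <;> simp
  simp_rw [h]
  fun_prop

theorem continuous_rotation : Continuous rotation := by
  have h : ∀ x, Continuous fun a => (rotation a).1.1 x := fun x => by
    have h₁ : Continuous fun z : Circle => (z : ℂ).re :=
      Complex.continuous_re.comp (by fun_prop)
    have h₂ : Continuous fun z : Circle => (z : ℂ).im :=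
      Complex.continuous_im.comp (by fun_prop)
    refine continuous_mk (continuous_quat ?_ ?_ ?_ ?_) (continuous_quat ?_ ?_ ?_ ?_) <;> fun_prop
  refine continuous_of_apply h fun x => ?_
  simp_rw [← map_inv]
  exact (h x).comp continuous_inv

/-! ### Transitivity on imaginary units and connectedness of `G₂`. -/

theorem exists_unitQuaternion_coe {q : ℍ[ℝ]} (hq : q ≠ 0) :
    ∃ u : UnitQuaternion, (u : ℍ[ℝ]) = ‖q‖⁻¹ • q :=
  ⟨⟨‖q‖⁻¹ • q, by
    rw [mem_sphere_zero_iff_norm, norm_smul, norm_inv, norm_norm,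
      inv_mul_cancel₀ (norm_ne_zero_iff.2 hq)]⟩, rfl⟩

theorem exists_mul_eq_norm (n : ℍ[ℝ]) :
    ∃ p : UnitQuaternion, (p : ℍ[ℝ]) * n = ((‖n‖ : ℝ) : ℍ[ℝ]) := by
  by_cases hn : n = 0
  · exact ⟨1, by simp [hn]⟩
  · obtain ⟨u, hu⟩ := exists_unitQuaternion_coe (star_ne_zero.2 hn)
    refine ⟨u, ?_⟩
    rw [hu, smul_mul_assoc, Quaternion.star_mul_self, Quaternion.normSq_eq_norm_mul_self,
      norm_star, Quaternion.smul_coe, inv_mul_cancel_left₀ (norm_ne_zero_iff.2 hn)]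

/-- An imaginary quaternion can be rotated to a multiple of `e₂`, about `e₁` if it is orthogonal
to `e₁`. -/
theorem exists_conj_eq_e₂ {m : ℍ[ℝ]} (hm : m.re = 0) :
    ∃ q : UnitQuaternion, (q : ℍ[ℝ]) * m * star (q : ℍ[ℝ]) = quat 0 0 ‖m‖ 0 ∧
      (m.imI = 0 → (q : ℍ[ℝ]) * quat 0 1 0 0 = quat 0 1 0 0 * q) := by
  have hr : ‖m‖ * ‖m‖ = m.imI ^ 2 + m.imJ ^ 2 + m.imK ^ 2 := by
    rw [← Quaternion.normSq_eq_norm_mul_self, Quaternion.normSq_def', hm]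
    ring
  obtain ⟨q, hq, h₁, h₂⟩ : ∃ q : ℍ[ℝ], q ≠ 0 ∧ q * m = quat 0 0 ‖m‖ 0 * q ∧
      (m.imI = 0 → q * quat 0 1 0 0 = quat 0 1 0 0 * q) := by
    set r := ‖m‖
    -- As `m² = -r²`, the quaternion `q = r - e₂ m` satisfies `q m = r e₂ q`. It lies in `ℂ` when
    -- `m` is orthogonal to `e₁`. It vanishes only for `m = -r e₂`, where `q = e₁` serves.
    by_cases h : quat r 0 0 0 - quat 0 0 1 0 * m = 0
    · have hj : r + m.imJ = 0 := by simpa using congrArg (·.re) h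
      have hk : m.imK = 0 := by simpa using congrArg (·.imI) h
      have hi : m.imI = 0 := by simpa using congrArg (·.imK) h
      refine ⟨quat 0 1 0 0, fun h => by simpa using congrArg (·.imI) h, ?_, fun _ => rfl⟩
      ext <;> simp [hm, hk, hi]; linarith
    · refine ⟨_, h, ?_, fun hi => ?_⟩
      · ext <;> simp [hm] <;> grind
      · ext <;> simp [hm, hi]
  obtain ⟨u, hu⟩ := exists_unitQuaternion_coe hq
  have h₃ : (u : ℍ[ℝ]) * m = quat 0 0 ‖m‖ 0 * u := by
    rw [hu, smul_mul_assoc, h₁, mul_smul_comm]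
  refine ⟨u, by rw [h₃, mul_assoc, self_mul_star, mul_one], fun hi => ?_⟩
  rw [hu, smul_mul_assoc, h₂ hi, mul_smul_comm]

theorem ofPair_e₁ {p q : UnitQuaternion}
    (h : (q : ℍ[ℝ]) * quat 0 1 0 0 = quat 0 1 0 0 * q) : (ofPair (p, q)).1.1 e₁ = e₁ := by
  rw [ofPair_apply, e₁]
  apply Octonion.ext
  · rw [fst_mk, fst_mk, h, mul_assoc, self_mul_star, mul_one]
  · simp

/-- The identity component of `G₂`. -/
abbrev component : Subgroup G₂ := Subgroup.connectedComponentOfOne G₂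

theorem mem_component_of_continuous {X : Type*} [TopologicalSpace X] [ConnectedSpace X] [One X]
    {f : X → G₂} (hf : Continuous f) (h₁ : f 1 = 1) (x : X) : f x ∈ component :=
  (isPreconnected_range hf).subset_connectedComponent ⟨1, h₁⟩ ⟨x, rfl⟩

theorem ofPair_mem_component (a : UnitQuaternion × UnitQuaternion) : ofPair a ∈ component := by
  have : ConnectedSpace UnitQuaternion := isConnected_iff_connectedSpace.1
    (isConnected_sphere (by rw [Quaternion.rank_eq_four]; norm_num) _ zero_le_one)
  exact mem_component_of_continuous continuous_ofPair (map_one _) a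

theorem rotation_mem_component (z : Circle) : rotation z ∈ component := by
  have h : Continuous fun t : ℝ => rotation (Circle.exp t) :=
    continuous_rotation.comp Circle.exp.continuous
  obtain ⟨t, rfl⟩ := Circle.exp_surjective z
  exact (isPreconnected_range h).subset_connectedComponent ⟨0, by simp⟩ ⟨t, rfl⟩

theorem rotation_e₁ (z : Circle) : (rotation z).1.1 e₁ = e₁ := by
  rw [rotation_apply]
  apply Octonion.ext <;> ext <;> simp [rotationFun, e₁]

/-- The identity component of `G₂` moves every imaginary unit to `e₂`, with `e₁` fixed if the unit
is orthogonal to `e₁`. -/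
theorem exists_apply_eq_e₂ {x : Octonion} (hre : x.fst.re = 0) (hx : ‖x‖ = 1) :
    ∃ g ∈ component, g.1.1 x = e₂ ∧ (x.fst.imI = 0 → g.1.1 e₁ = e₁) := by
  obtain ⟨q, hq, hq'⟩ := exists_conj_eq_e₂ hre
  obtain ⟨p, hp⟩ := exists_mul_eq_norm (x.snd * star (q : ℍ[ℝ]))
  set a := ‖x.fst‖
  set b := ‖x.snd * star (q : ℍ[ℝ])‖
  have hy : (ofPair (p, q)).1.1 x = mk (quat 0 0 a 0) (b : ℍ[ℝ]) := by
    rw [ofPair_apply, hq, mul_assoc, hp]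
  have hab : a ^ 2 + b ^ 2 = 1 := by
    have h := norm_apply (ofPair (p, q)) x
    rw [hx, hy] at h
    have h' := norm_sq_eq (mk (quat 0 0 a 0) (b : ℍ[ℝ]))
    rw [h] at h'
    simp [Quaternion.normSq_def'] at h'
    exact h'.symm
  -- The rotation that brings `a e₂ + b e₄` to `e₂`.
  let z : Circle := ⟨⟨a, -b⟩, mem_sphere_zero_iff_norm.2 (by
    rw [Complex.norm_eq_sqrt_sq_add_sq]
    simp [hab])⟩
  have hz₁ : (z : ℂ).re = a := rfl
  have hz₂ : (z : ℂ).im = -b := rfl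
  refine ⟨rotation z * ofPair (p, q),
    mul_mem (rotation_mem_component z) (ofPair_mem_component _), ?_, fun hi => ?_⟩
  · rw [mul_apply, hy, rotation_apply]
    apply Octonion.ext <;> ext <;> simp [rotationFun, hz₁, hz₂, e₂] <;> linarith
  · rw [mul_apply, ofPair_e₁ (hq' hi), rotation_e₁]

theorem norm_e₁ : ‖e₁‖ = 1 := by
  rw [← sq_eq_sq₀ (norm_nonneg _) zero_le_one, norm_sq_eq]
  simp [e₁, Quaternion.normSq_def']

theorem norm_e₂ : ‖e₂‖ = 1 := by
  rw [← sq_eq_sq₀ (norm_nonneg _) zero_le_one, norm_sq_eq]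
  simp [e₂, Quaternion.normSq_def']

theorem norm_e₄ : ‖e₄‖ = 1 := by
  rw [← sq_eq_sq₀ (norm_nonneg _) zero_le_one, norm_sq_eq]
  simp [e₄]

/-- An automorphism that fixes `y` preserves the bilinear form `(x, y) ↦ re (y x)` in `x`. -/
theorem re_mul_apply {α : G₂} {y : Octonion} (hα : α.1.1 y = y) (x : Octonion) :
    (y * α.1.1 x).fst.re = (y * x).fst.re := by
  have h := re_apply α (y * x)
  rwa [map_mul', hα] at h

theorem imI_apply {α : G₂} (hα : α.1.1 e₁ = e₁) (x : Octonion) :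
    (α.1.1 x).fst.imI = x.fst.imI := by
  simpa [e₁] using re_mul_apply hα x

theorem imJ_apply {α : G₂} (hα : α.1.1 e₂ = e₂) (x : Octonion) :
    (α.1.1 x).fst.imJ = x.fst.imJ := by
  simpa [e₂] using re_mul_apply hα x

theorem imK_apply {α : G₂} (h₁ : α.1.1 e₁ = e₁) (h₂ : α.1.1 e₂ = e₂) (x : Octonion) :
    (α.1.1 x).fst.imK = x.fst.imK := by
  simpa [e₁, e₂] using re_mul_apply (show α.1.1 (e₁ * e₂) = e₁ * e₂ by rw [map_mul', h₁, h₂]) x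

/-- The automorphisms that fix `ℍ` are the maps `m + n e₄ ↦ m + (p n) e₄`. -/
theorem exists_eq_ofPair {α : G₂} (h₁ : α.1.1 e₁ = e₁) (h₂ : α.1.1 e₂ = e₂) :
    ∃ p : UnitQuaternion, α = ofPair (p, 1) := by
  -- Fixing `ℍ` preserves the four coordinates along `ℍ`, and those of `e₄` vanish. So `α e₄ = p
  -- e₄`, with `p` a unit because `α` is an isometry.
  have h₀ : (α.1.1 e₄).fst = 0 := by
    ext
    · rw [re_apply]; rfl
    · rw [imI_apply h₁]; rfl
    · rw [imJ_apply h₂]; rfl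
    · rw [imK_apply h₁ h₂]; rfl
  have hn : ‖(α.1.1 e₄).snd‖ = 1 := by
    rw [← sq_eq_sq₀ (norm_nonneg _) zero_le_one]
    have h := norm_sq_eq (α.1.1 e₄)
    rw [norm_apply, norm_e₄, h₀, map_zero, zero_add, Quaternion.normSq_eq_norm_mul_self] at h
    rw [h, sq]
  refine ⟨⟨(α.1.1 e₄).snd, mem_sphere_zero_iff_norm.2 hn⟩, ext_generators ?_ ?_ ?_⟩
  · rw [h₁, ofPair_e₁ (by simp)]
  · rw [h₂, ofPair_apply]
    apply Octonion.ext <;> simp [e₂]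
  · rw [ofPair_apply]
    apply Octonion.ext
    · rw [h₀]; simp [e₄]
    · simp [e₄]

theorem component_eq_top : component = ⊤ := by
  refine eq_top_iff.2 fun α _ => ?_
  obtain ⟨h, hh, hh₂, -⟩ := exists_apply_eq_e₂ (x := e₁) rfl norm_e₁
  obtain ⟨g, hg, hg₂, -⟩ := exists_apply_eq_e₂ (x := α.1.1 e₁)
    (by rw [re_apply]; rfl) (by rw [norm_apply, norm_e₁])
  have hβ : (h⁻¹ * g * α).1.1 e₁ = e₁ := by
    rw [mul_apply, mul_apply, hg₂, inv_apply_eq hh₂]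
  set β := h⁻¹ * g * α with hβ_def
  -- Since `β` fixes `e₁`, the unit `β e₂` is still orthogonal to `e₁`, so `k` can be taken to fix
  -- `e₁`.
  obtain ⟨k, hk, hk₂, hk₁⟩ := exists_apply_eq_e₂ (x := β.1.1 e₂)
    (by rw [re_apply]; rfl) (by rw [norm_apply, norm_e₂])
  obtain ⟨p, hp⟩ := exists_eq_ofPair (α := k * β)
    (by rw [mul_apply, hβ, hk₁ (by rw [imI_apply hβ]; rfl)]) (by rw [mul_apply, hk₂])
  have hα : α = g⁻¹ * h * (k⁻¹ * ofPair (p, 1)) := by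
    rw [← hp, hβ_def]
    group
  rw [hα]
  exact mul_mem (mul_mem (inv_mem hg) hh) (mul_mem (inv_mem hk) (ofPair_mem_component _))

theorem connectedSpace : ConnectedSpace G₂ :=
  connectedSpace_iff_connectedComponent.2
    ⟨1, congrArg (fun H : Subgroup G₂ => (H : Set G₂)) component_eq_top⟩

/-! ### The torus `U(1) × U(1)` in `G₂` and its kernel. -/

theorem norm_coeComplex (z : ℂ) : ‖(z : ℍ[ℝ])‖ = ‖z‖ := by
  rw [← sq_eq_sq₀ (norm_nonneg _) (norm_nonneg _), ← Complex.normSq_eq_norm_sq, sq,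
    ← Quaternion.normSq_eq_norm_mul_self, Quaternion.normSq_def', Complex.normSq_apply]
  simp
  ring

/-- The inclusion of `U(1) ⊂ ℂ ⊂ ℍ` in the unit quaternions. -/
def circleToQuaternion : Circle →* UnitQuaternion where
  toFun z := ⟨((z : ℂ) : ℍ[ℝ]), by
    rw [mem_sphere_zero_iff_norm, norm_coeComplex, Circle.norm_coe]⟩
  map_one' := Subtype.ext (by simp)
  map_mul' z w := Subtype.ext (by simp)

theorem coe_circleToQuaternion (z : Circle) :
    ((circleToQuaternion z : UnitQuaternion) : ℍ[ℝ]) = ((z : ℂ) : ℍ[ℝ]) := rfl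

theorem continuous_circleToQuaternion : Continuous circleToQuaternion := by
  refine Continuous.subtype_mk ?_ _
  have h : Continuous fun z : Circle => Quaternion.ofComplex (z : ℂ) :=
    (Quaternion.ofComplex.toLinearMap.continuous_of_finiteDimensional).comp (by fun_prop)
  exact h

theorem exists_circle_of_commute {q : UnitQuaternion}
    (h : (q : ℍ[ℝ]) * quat 0 1 0 0 = quat 0 1 0 0 * q) :
    ∃ z : Circle, circleToQuaternion z = q := by
  have hJ : (q : ℍ[ℝ]).imJ = 0 := by
    have := congrArg (·.imK) h
    simp at this
    linarith
  have hK : (q : ℍ[ℝ]).imK = 0 := by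
    have := congrArg (·.imJ) h
    simp at this
    linarith
  have hq : (((⟨(q : ℍ[ℝ]).re, (q : ℍ[ℝ]).imI⟩ : ℂ)) : ℍ[ℝ]) = q := by
    ext <;> simp [hJ, hK]
  refine ⟨⟨⟨(q : ℍ[ℝ]).re, (q : ℍ[ℝ]).imI⟩, mem_sphere_zero_iff_norm.2 ?_⟩, Subtype.ext hq⟩
  rw [← norm_coeComplex, hq]
  exact mem_sphere_zero_iff_norm.1 q.2

/-- The action of `U(1) × U(1)` on `𝔒` by `m + n e₄ ↦ t m t̄ + (s n t̄) e₄`. -/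
def ofCirclePair : Circle × Circle →* G₂ :=
  ofPair.comp (circleToQuaternion.prodMap circleToQuaternion)

theorem ofCirclePair_eq (s t : Circle) :
    ofCirclePair (s, t) = ofPair (circleToQuaternion s, circleToQuaternion t) := rfl

theorem ofCirclePair_apply (s t : Circle) (x : Octonion) :
    (ofCirclePair (s, t)).1.1 x =
      .mk (((t : ℂ) : ℍ[ℝ]) * x.fst * star ((t : ℂ) : ℍ[ℝ]))
        (((s : ℂ) : ℍ[ℝ]) * x.snd * star ((t : ℂ) : ℍ[ℝ])) := rfl

theorem continuous_ofCirclePair : Continuous ofCirclePair :=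
  continuous_ofPair.comp
    (continuous_circleToQuaternion.prodMap continuous_circleToQuaternion)

theorem ofCirclePair_eq_one_iff (a : Circle × Circle) :
    ofCirclePair a = 1 ↔ a ∈ diagZ₂ := by
  obtain ⟨s, t⟩ := a
  constructor
  · intro h
    have h₂ := congrArg (fun α : G₂ => α.1.1 e₂) h
    have h₄ := congrArg (fun α : G₂ => α.1.1 e₄) h
    simp only [ofCirclePair_apply, one_apply] at h₂ h₄
    have h₂ := congrArg Octonion.fst h₂
    have h₄ := congrArg Octonion.snd h₄
    simp only [fst_mk, snd_mk, e₂, e₄, mul_one] at h₂ h₄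
    have hs : s = t := by
      have h := congrArg (· * ((t : ℂ) : ℍ[ℝ])) h₄
      have ht := star_mul_self (circleToQuaternion t)
      rw [coe_circleToQuaternion] at ht
      simp only [mul_assoc, ht, mul_one, one_mul] at h
      refine Circle.ext (Complex.ext ?_ ?_)
      · simpa using congrArg (·.re) h
      · simpa using congrArg (·.imI) h
    -- Here `t e₂ t̄ = t² e₂`, so the `e₂` coordinate reads `re² - im² = 1`; with `re² + im² = 1`
    -- this leaves `t = ±1`.
    have ha := congrArg (·.imJ) h₂
    have hb := re_sq_add_im_sq t
    simp at ha
    have him : (t : ℂ).im = 0 := by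
      have : (t : ℂ).im * (t : ℂ).im = 0 := by linarith
      simpa using this
    have hre : (t : ℂ).re = 1 ∨ (t : ℂ).re = -1 := by
      refine mul_self_eq_one_iff.1 ?_
      rwa [him, mul_zero, add_zero] at hb
    subst hs
    rcases hre with hre | hre
    · have : s = 1 := Circle.ext (Complex.ext (by simpa using hre) (by simpa using him))
      exact Or.inl (by rw [this])
    · have : s = -1 := Circle.ext (Complex.ext (by simpa using hre) (by simpa using him))
      exact Or.inr (by rw [this]; rfl)
  · rintro (h | h)
    · rw [h]
      exact map_one _
    · rw [h]
      refine ext_apply fun x => ?_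
      rw [ofCirclePair_apply, one_apply]
      apply Octonion.ext <;> ext <;> simp

/-! ### `γ₃` and `w₃` as torus elements; their orders. -/

/-- `ω` as an element of `U(1)`. -/
def omegaCircle : Circle := ⟨omega₃, mem_sphere_zero_iff_norm.2 (by
  have h := congrArg (‖·‖) omega₃_mul_conj
  simp only [norm_mul, norm_star, norm_one] at h
  nlinarith [norm_nonneg omega₃])⟩

theorem coe_omegaCircle : (omegaCircle : ℂ) = omega₃ := rfl

theorem omega₃_cube : omega₃ ^ 3 = 1 := by
  have h : √3 * √3 = 3 := Real.mul_self_sqrt (by norm_num)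
  apply Complex.ext <;> simp [omega₃, pow_succ] <;> grind

theorem omegaCircle_cube : omegaCircle ^ 3 = 1 :=
  Circle.ext (by rw [Circle.coe_pow, coe_omegaCircle, omega₃_cube, Circle.coe_one])

theorem gamma₃_eq : gamma₃ = ofCirclePair (omegaCircle, 1) := by
  refine ext_apply fun x => ?_
  rw [ofCirclePair_apply]
  change gamma₃Lin x = _
  rw [gamma₃Lin_apply]
  apply Octonion.ext <;> simp [coe_omegaCircle]

/-- The torus multiplies `n` by `t̄` on the right whereas `w₃` multiplies it by `ω`, whence the
inverse. -/
theorem w₃_eq : w₃ = ofCirclePair (1, omegaCircle⁻¹) := by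
  refine ext_apply fun x => ?_
  rw [ofCirclePair_apply]
  change w₃Lin x = _
  have h : ((omegaCircle⁻¹ : Circle) : ℂ) = star omega₃ := Circle.coe_inv_eq_conj _
  rw [w₃Lin_apply, h, ← coeComplex_star₃, star_star, Circle.coe_one, Quaternion.coeComplex_one,
    one_mul]

theorem omegaCircle_pow_eq_one {i : ℕ} (hi : i < 3) (h : omegaCircle ^ i = 1) : i = 0 := by
  have h3 : √3 ≠ 0 := by positivity
  have h' := congrArg (fun z : Circle => (z : ℂ).im) h
  simp only [Circle.coe_pow, coe_omegaCircle, Circle.coe_one] at h'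
  interval_cases i
  · rfl
  · simp [omega₃] at h'
  · simp [omega₃, pow_succ] at h'
    exact absurd (by linarith) h3

theorem pow_mul_pow_eq (i j : ℕ) :
    gamma₃ ^ i * w₃ ^ j = ofCirclePair (omegaCircle ^ i, (omegaCircle ^ j)⁻¹) := by
  rw [gamma₃_eq, w₃_eq, ← map_pow, ← map_pow, ← map_mul]
  simp

theorem pow_mul_pow_eq_one {i j : ℕ} (hi : i < 3) (hj : j < 3) (h : gamma₃ ^ i * w₃ ^ j = 1) :
    i = 0 ∧ j = 0 := by
  rw [pow_mul_pow_eq, ofCirclePair_eq_one_iff] at h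
  -- The cube of a power of `ω` is `1`, that of `-1` is `-1`; so the element `(-1, -1)` of the
  -- kernel is never reached.
  have hne : ∀ k : ℕ, omegaCircle ^ k ≠ -1 := fun k hk => by
    have h := congrArg (· ^ 3) hk
    simp only [← pow_mul] at h
    rw [mul_comm, pow_mul, omegaCircle_cube, one_pow] at h
    have h' := congrArg (fun z : Circle => (z : ℂ).re) h
    norm_num [pow_succ] at h'
  rcases h with h | h
  · exact ⟨omegaCircle_pow_eq_one hi (congrArg Prod.fst h),
      omegaCircle_pow_eq_one hj (inv_eq_one.1 (congrArg Prod.snd h))⟩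
  · exact absurd (congrArg Prod.fst h) (hne i)

theorem gamma₃_cube : gamma₃ ^ 3 = 1 := by
  rw [gamma₃_eq, ← map_pow, Prod.pow_mk, omegaCircle_cube, one_pow]
  exact map_one _

theorem w₃_cube : w₃ ^ 3 = 1 := by
  rw [w₃_eq, ← map_pow, Prod.pow_mk, inv_pow, omegaCircle_cube, one_pow, inv_one]
  exact map_one _

theorem commute_gamma₃_w₃ : Commute gamma₃ w₃ := by
  rw [gamma₃_eq, w₃_eq]
  exact (Commute.all _ _).map ofCirclePair

theorem orderOf_gamma₃ : orderOf gamma₃ = 3 :=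
  have : Fact (Nat.Prime 3) := ⟨Nat.prime_three⟩
  orderOf_eq_prime gamma₃_cube fun h =>
    absurd (pow_mul_pow_eq_one (i := 1) (j := 0) (by norm_num) (by norm_num) (by simp [h])).1
      one_ne_zero

theorem orderOf_w₃ : orderOf w₃ = 3 :=
  have : Fact (Nat.Prime 3) := ⟨Nat.prime_three⟩
  orderOf_eq_prime w₃_cube fun h =>
    absurd (pow_mul_pow_eq_one (i := 0) (j := 1) (by norm_num) (by norm_num) (by simp [h])).2
      one_ne_zero

end G₂

section GammaSymmetric

theorem mem_fixedSubgroup_tildeAut {G : Type*} [Group G] {g α : G} :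
    α ∈ fixedSubgroup (tildeAut g) ↔ Commute g α := by
  change g⁻¹ * α * g⁻¹⁻¹ = α ↔ g * α = α * g
  rw [inv_inv, mul_assoc, inv_mul_eq_iff_eq_mul, eq_comm]

/-- The homomorphism from `ℤₙ × ℤₙ` given by two commuting elements whose `n`-th powers are `1`. -/
def homOfCommute {M : Type*} [Monoid M] (n : ℕ) [NeZero n] {a b : M} (ha : a ^ n = 1)
    (hb : b ^ n = 1) (hab : Commute a b) : Multiplicative (ZMod n × ZMod n) →* M where
  toFun x := a ^ x.toAdd.1.val * b ^ x.toAdd.2.val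
  map_one' := by simp
  map_mul' x y := by
    rw [toAdd_mul, Prod.fst_add, Prod.snd_add, ZMod.val_add, ZMod.val_add, ← pow_eq_pow_mod _ ha,
      ← pow_eq_pow_mod _ hb, pow_add, pow_add, mul_assoc, mul_assoc,
      ← mul_assoc (b ^ _) (a ^ _), ((hab.symm.pow_pow _ _).eq), mul_assoc]

end GammaSymmetric

/-! ### Determination of `K`. -/

namespace G₂

open Octonion

/-- The subgroup `(G₂)^γ₃ ∩ (G₂)^w₃`. -/
abbrev fixedGammaW : Subgroup G₂ := fixedSubgroup (tildeAut gamma₃) ⊓ fixedSubgroup (tildeAut w₃)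

theorem mem_fixedGammaW {α : G₂} : α ∈ fixedGammaW ↔ Commute gamma₃ α ∧ Commute w₃ α := by
  rw [Subgroup.mem_inf, mem_fixedSubgroup_tildeAut, mem_fixedSubgroup_tildeAut]

theorem ofCirclePair_mem (a : Circle × Circle) : ofCirclePair a ∈ fixedGammaW := by
  rw [mem_fixedGammaW, gamma₃_eq, w₃_eq]
  exact ⟨(Commute.all _ _).map ofCirclePair, (Commute.all _ _).map ofCirclePair⟩

theorem commute_apply {α β : G₂} (h : Commute β α) (x : Octonion) :
    β.1.1 (α.1.1 x) = α.1.1 (β.1.1 x) :=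
  congrArg (fun g : G₂ => g.1.1 x) h.eq

theorem w₃_apply (x : Octonion) : w₃.1.1 x =
    .mk (((star omega₃ : ℂ) : ℍ[ℝ]) * x.fst * (omega₃ : ℍ[ℝ])) (x.snd * (omega₃ : ℍ[ℝ])) :=
  w₃Lin_apply x

theorem gamma₃_apply (x : Octonion) :
    gamma₃.1.1 x = .mk x.fst ((omega₃ : ℍ[ℝ]) * x.snd) := rfl

theorem sqrt_three_mul_self : √3 * √3 = 3 := Real.mul_self_sqrt (by norm_num)

theorem snd_eq_zero_of_gamma₃ {x : Octonion} (h : gamma₃.1.1 x = x) : x.snd = 0 := by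
  have hs := sqrt_three_mul_self
  rw [gamma₃_apply] at h
  have h := congrArg Octonion.snd h
  rw [snd_mk] at h
  have h₁ := congrArg (·.re) h
  have h₂ := congrArg (·.imI) h
  have h₃ := congrArg (·.imJ) h
  have h₄ := congrArg (·.imK) h
  simp [omega₃] at h₁ h₂ h₃ h₄
  ext <;> simp <;> grind

/-- The fixed space of `γ₃` is `ℍ`, and whatever commutes with `γ₃` preserves it. -/
theorem gamma₃_fix_apply {α : G₂} (h : Commute gamma₃ α) (m : ℍ[ℝ]) :
    (α.1.1 (mk m 0)).snd = 0 := by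
  refine snd_eq_zero_of_gamma₃ ?_
  rw [commute_apply h, gamma₃_apply]
  simp

theorem apply_e₁_of_mem {α : G₂} (hα : α ∈ fixedGammaW) : α.1.1 e₁ = e₁ := by
  have hs := sqrt_three_mul_self
  obtain ⟨hγ, hw⟩ := mem_fixedGammaW.1 hα
  set u := α.1.1 e₁ with hu
  set v := α.1.1 e₂ with hv
  have hu₂ : u.snd = 0 := gamma₃_fix_apply hγ _
  have hv₂ : v.snd = 0 := gamma₃_fix_apply hγ _
  have hur : u.fst.re = 0 := by rw [hu, re_apply]; rfl
  have hvr : v.fst.re = 0 := by rw [hv, re_apply]; rfl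
  have hwu : w₃.1.1 u = u := by
    rw [hu, commute_apply hw]
    congr 1
    rw [w₃_apply]
    apply Octonion.ext <;> ext <;> simp [e₁, omega₃] <;> grind
  have huj : u.fst.imJ = 0 ∧ u.fst.imK = 0 := by
    rw [w₃_apply] at hwu
    have h := congrArg Octonion.fst hwu
    rw [fst_mk] at h
    have h₁ := congrArg (·.imJ) h
    have h₂ := congrArg (·.imK) h
    simp [omega₃] at h₁ h₂
    constructor <;> grind
  -- The image under `α` of `w₃ e₂ = ω e₂ = -(1/2) e₂ + (√3/2) e₁ e₂`.
  have hwv : w₃.1.1 v = (-(1 / 2) : ℝ) • v + (√3 / 2) • (u * v) := by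
    rw [hv, hu, commute_apply hw, ← map_mul', ← map_smul, ← map_smul, ← map_add]
    congr 1
    rw [w₃_apply]
    apply Octonion.ext <;> ext <;> simp [e₁, e₂, omega₃] <;> grind
  -- Orthogonality of `e₁` and `e₂`, carried over by `α`.
  have huv : u.fst.imI * v.fst.imI = 0 := by
    have h : (α.1.1 (e₁ * e₂)).fst.re = 0 := by
      rw [re_apply]
      simp [e₁, e₂]
    rw [map_mul', ← hu, ← hv] at h
    simpa [hu₂, hv₂, hur, hvr, huj.1, huj.2] using h
  have hun : u.fst.imI ^ 2 = 1 := by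
    have h := norm_sq_eq u
    rw [hu, norm_apply, ← hu, norm_e₁, hu₂, Quaternion.normSq_def', hur, huj.1, huj.2] at h
    simpa using h.symm
  have hvn : v.fst.imI ^ 2 + v.fst.imJ ^ 2 + v.fst.imK ^ 2 = 1 := by
    have h := norm_sq_eq v
    rw [hv, norm_apply, ← hv, norm_e₂, hv₂, Quaternion.normSq_def', hvr] at h
    simpa using h.symm
  have hvi : v.fst.imI = 0 := by
    rcases mul_eq_zero.1 huv with h | h
    · rw [h] at hun
      norm_num at hun
    · exact h
  -- Now `u = ± e₁` and `v` is a unit of `ℂ e₂`, on which `w₃` is multiplication by `ω`; `u = -e₁`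
  -- would make it multiplication by `ω̄`.
  have hui : u.fst.imI = 1 := by
    rw [w₃_apply] at hwv
    have h := congrArg Octonion.fst hwv
    rw [fst_mk] at h
    have h₁ := congrArg (·.imJ) h
    have h₂ := congrArg (·.imK) h
    simp [omega₃, hu₂, hv₂, hur, hvr, huj.1, huj.2, hvi] at h₁ h₂
    grind
  apply Octonion.ext
  · ext <;> simp [e₁, hur, huj.1, huj.2, hui]
  · rw [hu₂]
    rfl

/-- `(G₂)^γ₃ ∩ (G₂)^w₃` is the image of `U(1) × U(1)`. -/
theorem exists_ofCirclePair_eq {α : G₂} (hα : α ∈ fixedGammaW) : ∃ a, ofCirclePair a = α := by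
  have h₁ := apply_e₁_of_mem hα
  have h₂ : (α.1.1 e₂).snd = 0 := gamma₃_fix_apply (mem_fixedGammaW.1 hα).1 _
  have hn : ‖(α.1.1 e₂).fst‖ = 1 := by
    rw [← sq_eq_sq₀ (norm_nonneg _) zero_le_one]
    have h := norm_sq_eq (α.1.1 e₂)
    rw [norm_apply, norm_e₂, h₂, map_zero, add_zero, Quaternion.normSq_eq_norm_mul_self] at h
    rw [h, sq]
  obtain ⟨q, hq, hq₁⟩ := exists_conj_eq_e₂ (m := (α.1.1 e₂).fst) (by rw [re_apply]; rfl)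
  obtain ⟨t, rfl⟩ := exists_circle_of_commute (hq₁ (by rw [imI_apply h₁]; rfl))
  set δ := ofCirclePair (1, t) * α with hδ
  have hδ_mem : δ ∈ fixedGammaW := mul_mem (ofCirclePair_mem _) hα
  obtain ⟨p, hp⟩ := exists_eq_ofPair (apply_e₁_of_mem hδ_mem) (by
    rw [hδ, mul_apply, ofCirclePair_eq, ofPair_apply, hq, hn, h₂, mul_zero, zero_mul]
    rfl)
  -- Commutation of `δ` with `γ₃`, evaluated at `e₄`, says `ω p = p ω`, which forces `p` into `ℂ`.
  obtain ⟨s, rfl⟩ : ∃ s, circleToQuaternion s = p := by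
    refine exists_circle_of_commute ?_
    have h := congrArg Octonion.snd (commute_apply (mem_fixedGammaW.1 hδ_mem).1 e₄)
    rw [hp] at h
    simp only [gamma₃_apply, ofPair_apply, snd_mk, e₄, mul_one, Metric.unitSphere.coe_one,
      star_one] at h
    have hs : √3 ≠ 0 := by positivity
    have h₁ := congrArg (·.imJ) h
    have h₂ := congrArg (·.imK) h
    simp [omega₃] at h₁ h₂
    have hJ : (p : ℍ[ℝ]).imJ = 0 := by
      refine (mul_eq_zero.1 (?_ : √3 * (p : ℍ[ℝ]).imJ = 0)).resolve_left hs
      linarith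
    have hK : (p : ℍ[ℝ]).imK = 0 := by
      refine (mul_eq_zero.1 (?_ : √3 * (p : ℍ[ℝ]).imK = 0)).resolve_left hs
      linarith
    ext <;> simp [hJ, hK]
  refine ⟨(1, t)⁻¹ * (s, 1), ?_⟩
  rw [map_mul, map_inv, ofCirclePair_eq s, map_one, ← hp, hδ, inv_mul_cancel_left]

/-- The homomorphism `(U(1) × U(1)) / ℤ₂ → (G₂)^γ₃ ∩ (G₂)^w₃`. -/
def quotientHom : (Circle × Circle) ⧸ diagZ₂ →* fixedGammaW :=
  QuotientGroup.lift diagZ₂ (ofCirclePair.codRestrict fixedGammaW ofCirclePair_mem)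
    fun a ha => Subtype.ext ((ofCirclePair_eq_one_iff a).2 ha)

theorem quotientHom_bijective : Function.Bijective quotientHom := by
  constructor
  · refine (injective_iff_map_eq_one _).2 fun x => ?_
    induction x using QuotientGroup.induction_on with
    | H a =>
      intro h
      exact (QuotientGroup.eq_one_iff a).2 ((ofCirclePair_eq_one_iff a).1 (congrArg Subtype.val h))
  · rintro ⟨α, hα⟩
    obtain ⟨a, rfl⟩ := exists_ofCirclePair_eq hα
    exact ⟨QuotientGroup.mk a, rfl⟩

theorem continuous_quotientHom : Continuous quotientHom :=
  Continuous.quotient_lift (continuous_ofCirclePair.subtype_mk _) _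

/-- The isomorphism of topological groups `(U(1) × U(1)) / ℤ₂ ≅ (G₂)^γ₃ ∩ (G₂)^w₃`. -/
def quotientEquiv : (Circle × Circle) ⧸ diagZ₂ ≃ₜ* fixedGammaW :=
  let e := MulEquiv.ofBijective quotientHom quotientHom_bijective
  { e with
    continuous_toFun := continuous_quotientHom
    continuous_invFun :=
      (Continuous.homeoOfEquivCompactToT2 (f := e.toEquiv) continuous_quotientHom).symm.continuous }

/-! ### Effectiveness, the homomorphism `ρ`, and the symmetric space. -/

/-- An automorphism that fixes the `G₂`-orbit of `e₁` is trivial. -/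
theorem eq_one_of_fix_orbit {α : G₂} (h : ∀ g : G₂, α.1.1 (g.1.1 e₁) = g.1.1 e₁) : α = 1 := by
  obtain ⟨g, -, hg, -⟩ := exists_apply_eq_e₂ (x := e₁) rfl norm_e₁
  obtain ⟨k, -, hk, -⟩ := exists_apply_eq_e₂ (x := e₄) rfl norm_e₄
  refine ext_generators (h 1) ?_ ?_
  · have := h g
    rwa [hg] at this
  · have := h (k⁻¹ * g)
    rwa [mul_apply, hg, inv_apply_eq hk] at this

theorem eq_one_of_conj_mem {α : G₂} (h : ∀ g : G₂, g⁻¹ * α * g ∈ fixedGammaW) : α = 1 := by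
  refine eq_one_of_fix_orbit fun g => ?_
  have := congrArg g.1.1 (apply_e₁_of_mem (h g))
  rwa [mul_apply, mul_apply, apply_inv_apply] at this

theorem toPermHom_ker : (MulAction.toPermHom G₂ (G₂ ⧸ fixedGammaW)).ker = ⊥ := by
  refine (Subgroup.eq_bot_iff_forall _).2 fun α hα => eq_one_of_conj_mem fun g => ?_
  have h : α • (QuotientGroup.mk g : G₂ ⧸ fixedGammaW) = QuotientGroup.mk g :=
    DFunLike.congr_fun (MonoidHom.mem_ker.1 hα) (QuotientGroup.mk g)
  have h' : g⁻¹ * (α * g) ∈ fixedGammaW := QuotientGroup.eq.1 h.symm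
  rwa [← mul_assoc] at h'

/-- The homomorphism `ℤ₃ × ℤ₃ → G₂` given by `γ₃⁻¹` and `w₃⁻¹`. -/
def gammaWHom : Multiplicative (ZMod 3 × ZMod 3) →* G₂ :=
  homOfCommute 3 (a := gamma₃⁻¹) (b := w₃⁻¹) (by rw [inv_pow, gamma₃_cube, inv_one])
    (by rw [inv_pow, w₃_cube, inv_one]) commute_gamma₃_w₃.inv_inv

/-- The homomorphism `ρ : ℤ₃ × ℤ₃ → Aut(G₂)`. -/
def rho : Multiplicative (ZMod 3 × ZMod 3) →* MulAut G₂ := MulAut.conj.comp gammaWHom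

theorem gammaWHom_apply (x : Multiplicative (ZMod 3 × ZMod 3)) :
    gammaWHom x = gamma₃⁻¹ ^ x.toAdd.1.val * w₃⁻¹ ^ x.toAdd.2.val := rfl

theorem rho_gamma₃ : rho (Multiplicative.ofAdd (1, 0)) = tildeAut gamma₃ := by
  change MulAut.conj (gammaWHom _) = MulAut.conj gamma₃⁻¹
  rw [gammaWHom_apply]
  simp [ZMod.val_one'']

theorem rho_w₃ : rho (Multiplicative.ofAdd (0, 1)) = tildeAut w₃ := by
  change MulAut.conj (gammaWHom _) = MulAut.conj w₃⁻¹
  rw [gammaWHom_apply]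
  simp [ZMod.val_one'']

theorem gammaWHom_mem (x : Multiplicative (ZMod 3 × ZMod 3)) : gammaWHom x ∈ fixedGammaW := by
  have hγ : gamma₃ ∈ fixedGammaW := by rw [gamma₃_eq]; exact ofCirclePair_mem _
  have hw : w₃ ∈ fixedGammaW := by rw [w₃_eq]; exact ofCirclePair_mem _
  exact mul_mem (pow_mem (inv_mem hγ) _) (pow_mem (inv_mem hw) _)

theorem rho_injective : Function.Injective rho := by
  refine (injective_iff_map_eq_one _).2 fun x hx => ?_
  -- If `ρ x` is trivial, `gammaWHom x` is central, so it equals all its conjugates and they lie in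
  -- `K`.
  have h₁ : gammaWHom x = 1 := eq_one_of_conj_mem fun g => by
    have h : gammaWHom x * g * (gammaWHom x)⁻¹ = g := DFunLike.congr_fun hx g
    rw [mul_inv_eq_iff_eq_mul] at h
    rw [mul_assoc, h, inv_mul_cancel_left]
    exact gammaWHom_mem x
  rw [gammaWHom_apply, inv_pow, inv_pow, ← mul_inv_rev, inv_eq_one,
    ((commute_gamma₃_w₃.pow_pow _ _).symm.eq)] at h₁
  have h₂ := pow_mul_pow_eq_one (ZMod.val_lt _) (ZMod.val_lt _) h₁
  exact Multiplicative.toAdd.injective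
    (Prod.ext ((ZMod.val_eq_zero _).1 h₂.1) ((ZMod.val_eq_zero _).1 h₂.2))

theorem fixedSubgroupOfHom_rho : fixedSubgroupOfHom rho = fixedGammaW := by
  refine le_antisymm (le_inf ?_ ?_) (le_iInf fun x α hα => ?_)
  · rw [← rho_gamma₃]
    exact iInf_le _ _
  · rw [← rho_w₃]
    exact iInf_le _ _
  · obtain ⟨hγ, hw⟩ := mem_fixedGammaW.1 hα
    have h : Commute (gammaWHom x) α :=
      (hγ.inv_left.pow_left _).mul_left (hw.inv_left.pow_left _)
    exact mul_inv_eq_iff_eq_mul.2 h.eq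

theorem isGammaSymmetricVia : IsGammaSymmetricVia G₂ fixedGammaW rho where
  isClosed := isClosed_coe
  connected := connectedSpace
  almostEffective := by
    rw [toPermHom_ker]
    infer_instance
  continuous x := by
    change Continuous fun α => gammaWHom x * α * (gammaWHom x)⁻¹
    fun_prop
  injective := rho_injective
  identityComponent_le :=
    (Subgroup.map_subtype_le _).trans fixedSubgroupOfHom_rho.le
  le_fixed := fixedSubgroupOfHom_rho.ge

end G₂

end

theorem theorem4p1p1 :
    -- `γ₃` and `w₃` have order `3`
    orderOf gamma₃ = 3 ∧ orderOf w₃ = 3 ∧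
    -- the isomorphism of topological groups induced by `(s, t) ↦ (m + n e₄ ↦ t m t̄ + (s n t̄) e₄)`
    (∃ Φ : (Circle × Circle) ⧸ diagZ₂ ≃ₜ*
        ↥(fixedSubgroup (tildeAut gamma₃) ⊓ fixedSubgroup (tildeAut w₃)),
      ∀ (s t : Circle) (m n : ℍ[ℝ]),
        (Φ (QuotientGroup.mk (s, t))).1.1.1 (Octonion.mk m n) =
          Octonion.mk (((t : ℂ) : ℍ[ℝ]) * m * star ((t : ℂ) : ℍ[ℝ]))
            (((s : ℂ) : ℍ[ℝ]) * n * star ((t : ℂ) : ℍ[ℝ]))) ∧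
    -- `G₂` is compact, and `G₂ / K` is a `ℤ₃ × ℤ₃`-symmetric space
    CompactSpace G₂ ∧
    ∃ ρ : Multiplicative (ZMod 3 × ZMod 3) →* MulAut G₂,
      ρ (Multiplicative.ofAdd (1, 0)) = tildeAut gamma₃ ∧
      ρ (Multiplicative.ofAdd (0, 1)) = tildeAut w₃ ∧
      IsGammaSymmetricVia G₂ (fixedSubgroup (tildeAut gamma₃) ⊓ fixedSubgroup (tildeAut w₃)) ρ := by
  refine ⟨G₂.orderOf_gamma₃, G₂.orderOf_w₃, ⟨G₂.quotientEquiv, fun s t m n => ?_⟩,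
    isCompact_iff_compactSpace.1 G₂.isCompact_coe, G₂.rho, G₂.rho_gamma₃, G₂.rho_w₃,
    G₂.isGammaSymmetricVia⟩
  exact G₂.ofCirclePair_apply s t (Octonion.mk m n)
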